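/- **Theorem.** There are a universal constant $C>0$ and a sampling algorithm with the following property. Consider any bandit range searching instance with $d$-dimensional weights ($d\ge 1$), which consists of - $n$ arms, where arm $a\in[n]$ has a known point $p_a\in\mathbb{R}$ and an unknown probability distribution $\nu_a$ on $[0,1]^d$ with mean vector (weight) $\mu_a\in[0,1]^d$; pulling arm $a$ reveals a fresh independent sample from $\nu_a$; - $q\ge 1$ known query intervals $I_i=[\ell_i,r_i]$ with $\ell_i<r_i$, $1\le i\le q$; and any parameters $\varepsilon>0$ and $\delta>0$. Let $\tau$ be the minimum cardinality of a hitting set of the intervals, i.e. of a finite set $H\subset\mathbb{R}$ such that every $I_i$ has a point $e\in H$ with $\ell_i<e<r_i$. For an interval $I$ write $\mathcal{A}(I)=\{a\in[n] : p_a\in I\}$, and call $T\subseteq\mathcal{A}(I)$ *$\varepsilon$-Pareto optimal for $I$* if, with componentwise inequalities and $\mathbb{1}$ the all-ones vector, - (a) for every $b\in\mathcal{A}(I)$ there is $a\in T$ with $\mu_a\ge\mu_b-\varepsilon\mathbb{1}$, and - (b) for every $a\in T$ there is no $b\in\mathcal{A}(I)$ with $\mu_b\ge\mu_a+\varepsilon\mathbb{1}$.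 Then the algorithm, which is given the points, the intervals, $\varepsilon$, $\delta$ and sample access to the arms (but not the distributions $\nu_a$), returns sets $T_1,\dots,T_q$ such that, with probability at least $1-\delta$, simultaneously for all $i$ the set $T_i$ is $\varepsilon$-Pareto optimal for $I_i$. Moreover, it always draws at most $$C\,\frac{nd}{\varepsilon^2}\,\max\Bigl\{1,\ \log\frac{\tau d}{\varepsilon\delta}\Bigr\}$$ samples; in particular $O\bigl(\frac{nd}{\varepsilon^2}\log\frac{\tau d}{\varepsilon\delta}\bigr)$ samples whenever $\tau d/(\varepsilon\delta)\ge e$. -/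

import Mathlib

open MeasureTheory

noncomputable section

namespace BanditRange

/-- A (deterministic, adaptive) sampling algorithm that has sample access to `n` arms, each of
whose samples is a vector in `[0,1]^d`, and that returns an element of `α`.  At every point the
algorithm either stops and returns a value, or it pulls an arm `a` and continues in a way that may
depend on the observed sample. -/
inductive SamplingAlgorithm (n d : ℕ) (α : Type) : Type where
  | output (o : α) : SamplingAlgorithm n d α
  | pull (a : Fin n) (next : (Fin d → unitInterval) → SamplingAlgorithm n d α) :
      SamplingAlgorithm n d α

/-- A table of samples: `X t a` is the vector observed if arm `a` is the arm pulled in round `t`. -/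
abbrev SampleTable (n d : ℕ) : Type := ℕ → Fin n → Fin d → unitInterval

namespace SamplingAlgorithm

variable {n d : ℕ} {α : Type}

/-- The value returned on the sample table `X`; the entry `X t a` is read only if arm `a`
is the one pulled in round `t`. -/
def run : SamplingAlgorithm n d α → SampleTable n d → α
  | output o, _ => o
  | pull a next, X => (next (X 0 a)).run (fun t => X (t + 1))

/-- The number of samples drawn on the sample table `X`. -/
def samplesDrawn : SamplingAlgorithm n d α → SampleTable n d → ℕ
  | output _, _ => 0
  | pull a next, X => (next (X 0 a)).samplesDrawn (fun t => X (t + 1)) + 1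

/-- The returned value is a measurable function of the samples (for a countable set `α` of
possible outputs). -/
def IsMeasurable (A : SamplingAlgorithm n d α) : Prop :=
  ∀ o : α, MeasurableSet {X : SampleTable n d | A.run X = o}

end SamplingAlgorithm

/-- The law of the sample table: all entries `X t a` are independent, and `X t a` has
distribution `ν a`. -/
def sampleLaw {n d : ℕ} (ν : Fin n → Measure (Fin d → unitInterval))
    [∀ a, IsProbabilityMeasure (ν a)] : Measure (SampleTable n d) :=
  Measure.infinitePi (fun _ : ℕ => Measure.pi ν)

/-- The weight of arm `a`: the mean vector of its distribution. -/
def weight {n d : ℕ} (ν : Fin n → Measure (Fin d → unitInterval)) (a : Fin n) : Fin d → ℝ :=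
  fun j => ∫ x, (x j : ℝ) ∂(ν a)

/-- The set of arms whose points lie in the interval `[l, r]`. -/
def armsIn {n : ℕ} (p : Fin n → ℝ) (l r : ℝ) : Set (Fin n) :=
  {a | p a ∈ Set.Icc l r}

/-- `T` is an `ε`-Pareto optimal set of arms for the interval `[l, r]`, where `w a` is the weight
vector and `p a` is the point of arm `a`.  Inequalities between vectors are componentwise, and
`fun _ => ε` is `ε` times the all-ones vector. -/
def IsParetoOptimal {n d : ℕ} (w : Fin n → Fin d → ℝ) (p : Fin n → ℝ) (l r ε : ℝ)
    (T : Finset (Fin n)) : Prop :=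
  (∀ a ∈ T, a ∈ armsIn p l r) ∧
  (∀ b ∈ armsIn p l r, ∃ a ∈ T, w b - (fun _ => ε) ≤ w a) ∧
  (∀ a ∈ T, ¬ ∃ b ∈ armsIn p l r, w a + (fun _ => ε) ≤ w b)

/-- The finite set `H` meets the interior of each of the intervals `[l i, r i]`. -/
def IsHittingSet {q : ℕ} (l r : Fin q → ℝ) (H : Finset ℝ) : Prop :=
  ∀ i, ∃ e ∈ H, l i < e ∧ e < r i

/-- The smallest cardinality of a hitting set of the intervals `[l i, r i]`. -/
def hittingNumber {q : ℕ} (l r : Fin q → ℝ) : ℕ :=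
  sInf {k | ∃ H : Finset ℝ, IsHittingSet l r H ∧ H.card = k}

/-- `A` solves the range searching instance with points `p` and query intervals `[l i, r i]`: for
all unknown distributions of the arms on `[0,1]^d`, with probability at least `1 - δ` it returns an
`ε`-Pareto optimal set of arms for every query interval simultaneously. -/
def IsCorrectOn {n d q : ℕ} (p : Fin n → ℝ) (l r : Fin q → ℝ) (ε δ : ℝ)
    (A : SamplingAlgorithm n d (Fin q → Finset (Fin n))) : Prop :=
  A.IsMeasurable ∧
  ∀ (ν : Fin n → Measure (Fin d → unitInterval)) [∀ a, IsProbabilityMeasure (ν a)],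
    1 - δ ≤ (sampleLaw ν).real
      {X | ∀ i, IsParetoOptimal (weight ν) p (l i) (r i) ε (A.run X i)}

end BanditRange

end

/-! The algorithm is batch elimination in phases, started from all arms. Phase `j` samples every
surviving arm `m j` times and rounds its empirical mean to a grid of width `1 / k`, `k = k₀ * 2 ^
j`. Fix a minimum hitting set `H`. A query interval has some `e ∈ H` in its interior, so if it
contains an arm, it contains every arm on the same side of `e` and no farther from `e`. Survivors
are therefore grouped by point of `H`, side, and estimated cell, which gives at most `K = 2 * τ * (k
+ 1) ^ d` groups, and the `t ≈ |S| / (8 * K)` arms nearest to `e` are kept in each. At most an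
eighth of the arms survive.

A union bound over all arms would put `n` inside the logarithm. `exists_reduction` avoids it.
Grouping by the true cells instead, and keeping one nearest arm per group, gives a set `D` of at
most `K` arms that does not depend on the samples. It suffices that the estimates on `D` are correct
(a union bound over `K` events) and that fewer than `t` arms have wrong estimates (Markov, at a cost
of order `K` times the failure probability of one arm). An arm of `D` is then either kept or
replaced by `t` nearer arms with the same estimate, one of which is estimated correctly.

The loss in phase `j` is `4 / k`, and these losses sum to less than `8 / k₀ ≤ ε / 4`. Costs per arm
grow like `4 ^ j * (j + 1)` while the number of arms shrinks like `8 ^ (-j)`, so the total is of the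
order of the first phase. Once `|S| < 8 * K`, a union bound over `S` is affordable and the empirical
Pareto front is returned (`isParetoOptimal_empiricalFront`). `exists_elimination` assembles this by
induction on `|S|`. -/

noncomputable section

namespace BanditRange

open ProbabilityTheory

/-! ### Non-adaptive batches of pulls. -/

namespace SamplingAlgorithm

variable {n d : ℕ} {α : Type}

/-- Pull the arms `s 0, s 1, …` in this order, and continue according to the observed samples. -/
def batch : {M : ℕ} → (Fin M → Fin n) →
    ((Fin M → Fin d → unitInterval) → SamplingAlgorithm n d α) → SamplingAlgorithm n d α
  | 0, _, k => k Fin.elim0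
  | _ + 1, s, k => pull (s 0) fun x => batch (Fin.tail s) fun y => k (Fin.cons x y)

/-- The samples that the schedule `s` of pulls reads off the table `X`. -/
def readings {M : ℕ} (s : Fin M → Fin n) (X : SampleTable n d) : Fin M → Fin d → unitInterval :=
  fun t => X t (s t)

lemma readings_succ {M : ℕ} (s : Fin (M + 1) → Fin n) (X : SampleTable n d) :
    readings s X = Fin.cons (X 0 (s 0)) (readings (Fin.tail s) fun t => X (t + 1)) := by
  funext t
  refine Fin.cases rfl (fun t => ?_) t
  simp [readings, Fin.tail]

lemma run_batch {M : ℕ} (s : Fin M → Fin n)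
    (k : (Fin M → Fin d → unitInterval) → SamplingAlgorithm n d α) (X : SampleTable n d) :
    (batch s k).run X = (k (readings s X)).run fun t => X (M + t) := by
  induction M generalizing X with
  | zero =>
    have : readings s X = Fin.elim0 := Subsingleton.elim _ _
    simp [batch, this]
  | succ M ih =>
    rw [batch, run, ih, readings_succ]
    congr 1
    funext t
    congr 1
    omega

lemma samplesDrawn_batch {M : ℕ} (s : Fin M → Fin n)
    (k : (Fin M → Fin d → unitInterval) → SamplingAlgorithm n d α) (X : SampleTable n d) :
    (batch s k).samplesDrawn X = M + (k (readings s X)).samplesDrawn fun t => X (M + t) := by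
  induction M generalizing X with
  | zero =>
    have : readings s X = Fin.elim0 := Subsingleton.elim _ _
    simp [batch, this]
  | succ M ih =>
    rw [batch, samplesDrawn, ih, readings_succ]
    have : (fun t => X (M + t + 1)) = fun t => X (M + 1 + t) := by
      funext t
      congr 1
      omega
    rw [this]
    omega

@[fun_prop]
lemma measurable_readings {M : ℕ} (s : Fin M → Fin n) :
    Measurable (readings (d := d) s) := by
  unfold readings
  fun_prop

lemma isMeasurable_output (o : α) : (output o : SamplingAlgorithm n d α).IsMeasurable := by
  intro o'
  simp only [run]
  exact MeasurableSet.const _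

/-- The continuation sees the batch only through a statistic with countably many values, so the
event splits into countably many pieces and no joint measurability of the continuations is needed.
-/
lemma isMeasurable_batch {β : Type} [MeasurableSpace β] [MeasurableSingletonClass β] [Countable β]
    {M : ℕ} (s : Fin M → Fin n) {g : (Fin M → Fin d → unitInterval) → β} (hg : Measurable g)
    {f : β → SamplingAlgorithm n d α} (hf : ∀ c, (f c).IsMeasurable) :
    (batch s fun y => f (g y)).IsMeasurable := by
  intro o
  have : {X : SampleTable n d | (batch s fun y => f (g y)).run X = o} =
      ⋃ c, {X | g (readings s X) = c} ∩ (fun X t => X (M + t)) ⁻¹' {X | (f c).run X = o} := by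
    ext X
    simp [run_batch]
  rw [this]
  refine MeasurableSet.iUnion fun c => MeasurableSet.inter ?_ ?_
  · exact (hg.comp (measurable_readings s)) (measurableSet_singleton c)
  · exact (by fun_prop : Measurable fun (X : SampleTable n d) t => X (M + t)) (hf c o)

lemma IsMeasurable.measurableSet_run_mem [Countable α] {A : SamplingAlgorithm n d α}
    (hA : A.IsMeasurable) (B : Set α) : MeasurableSet {X | A.run X ∈ B} := by
  have : {X | A.run X ∈ B} = ⋃ o ∈ B, {X | A.run X = o} := by
    ext X
    simp
  rw [this]
  exact MeasurableSet.biUnion B.to_countable fun o _ => hA o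

end SamplingAlgorithm

/-! ### Independence of a batch from the later rounds. -/

section Law

variable {n d : ℕ} (ν : Fin n → Measure (Fin d → unitInterval)) [∀ a, IsProbabilityMeasure (ν a)]

instance : IsProbabilityMeasure (sampleLaw ν) := by
  unfold sampleLaw
  infer_instance

lemma map_shift_sampleLaw (M : ℕ) :
    (sampleLaw ν).map (fun X t => X (M + t)) = sampleLaw ν :=
  Measure.map_infinitePi_infinitePi_of_inj (P := fun _ : ℕ => Measure.pi ν)
    (add_right_injective M)

lemma iIndepFun_rows : iIndepFun (fun (t : ℕ) (X : SampleTable n d) => X t) (sampleLaw ν) :=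
  iIndepFun_infinitePi (P := fun _ : ℕ => Measure.pi ν) (X := fun _ x => x) fun _ => measurable_id

lemma map_entry_sampleLaw (t : ℕ) (a : Fin n) : (sampleLaw ν).map (fun X => X t a) = ν a := by
  have h1 : (sampleLaw ν).map (fun X => X t) = Measure.pi ν :=
    Measure.infinitePi_map_eval (fun _ : ℕ => Measure.pi ν) t
  have h2 : (Measure.pi ν).map (fun x => x a) = ν a :=
    (measurePreserving_eval ν a).map_eq
  rw [← h2, ← h1, Measure.map_map (by fun_prop) (by fun_prop)]
  rfl

/-- The first event depends on rows before `M`, the second on rows from `M` on. The shifted table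
has the original law, so the second factor is the probability of `B` for a fresh run. -/
lemma indep_readings_shift {β : Type} [MeasurableSpace β] {M : ℕ} (s : Fin M → Fin n)
    {g : (Fin M → Fin d → unitInterval) → β} (hg : Measurable g) {U : Set β}
    (hU : MeasurableSet U) {B : Set (SampleTable n d)} (hB : MeasurableSet B) :
    (sampleLaw ν).real
        ({X | g (SamplingAlgorithm.readings s X) ∈ U} ∩ {X | (fun t => X (M + t)) ∈ B}) =
      (sampleLaw ν).real {X | g (SamplingAlgorithm.readings s X) ∈ U} *
        (sampleLaw ν).real B := by
  let m : ℕ → MeasurableSpace (SampleTable n d) :=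
    fun t => MeasurableSpace.comap (fun X => X t) inferInstance
  have hdisj : Disjoint (Set.Iio M) (Set.Ici M) := by
    rw [Set.disjoint_left]
    intro t h1 h2
    exact absurd (Set.mem_Iio.1 h1) (not_lt.2 (Set.mem_Ici.1 h2))
  have hind := indep_iSup_of_disjoint (m := m) (fun t => (measurable_pi_apply t).comap_le)
    (iIndepFun_rows ν) hdisj
  have key : ∀ (T : Set ℕ) (t : ℕ), t ∈ T →
      Measurable[⨆ i ∈ T, m i] (fun X : SampleTable n d => X t) := fun T t ht =>
    (comap_measurable _).mono (le_iSup₂_of_le t ht le_rfl) le_rfl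
  have h1 : MeasurableSet[⨆ i ∈ Set.Iio M, m i]
      {X : SampleTable n d | g (SamplingAlgorithm.readings s X) ∈ U} := by
    refine hg.comp ?_ hU
    refine @measurable_pi_lambda _ _ _ (_) _ _ fun t => ?_
    exact (measurable_pi_apply (s t)).comp (key _ _ t.2)
  have h2 : MeasurableSet[⨆ i ∈ Set.Ici M, m i]
      {X : SampleTable n d | (fun t => X (M + t)) ∈ B} := by
    refine Measurable.comp (g := id) measurable_id ?_ hB
    refine @measurable_pi_lambda _ _ _ (_) _ _ fun t => ?_
    exact key _ _ (Nat.le_add_right M t)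
  have h3 : (sampleLaw ν).real {X : SampleTable n d | (fun t => X (M + t)) ∈ B} =
      (sampleLaw ν).real B := by
    conv_rhs => rw [← map_shift_sampleLaw ν M]
    rw [map_measureReal_apply (by fun_prop) hB]
    rfl
  rw [← h3]
  have := (Indep_iff _ _ _).1 hind _ _ h1 h2
  rw [measureReal_def, this, ENNReal.toReal_mul]
  rfl

/-- If the first batch of samples fails with probability at most `p` and every algorithm run after
a successful first batch fails with probability at most `p'`, then the whole fails with
probability at most `p + p'`. -/
lemma measureReal_batch_le {α β : Type} [Countable α] [Fintype β] [MeasurableSpace β]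
    [MeasurableSingletonClass β] {M : ℕ} (s : Fin M → Fin n)
    {g : (Fin M → Fin d → unitInterval) → β} (hg : Measurable g)
    {f : β → SamplingAlgorithm n d α} (hf : ∀ c, (f c).IsMeasurable) (G : Set β) (B : Set α)
    {p p' : ℝ} (hp' : 0 ≤ p')
    (h1 : (sampleLaw ν).real {X | g (SamplingAlgorithm.readings s X) ∉ G} ≤ p)
    (h2 : ∀ c ∈ G, (sampleLaw ν).real {X | (f c).run X ∈ B} ≤ p') :
    (sampleLaw ν).real {X | (SamplingAlgorithm.batch s fun y => f (g y)).run X ∈ B} ≤ p + p' := by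
  classical
  set S : β → Set (SampleTable n d) := fun c => {X | g (SamplingAlgorithm.readings s X) ∈ ({c} : Set β)}
  set E : β → Set (SampleTable n d) := fun c => {X | (fun t => X (M + t)) ∈ {X | (f c).run X ∈ B}}
  have hmg : Measurable fun X : SampleTable n d => g (SamplingAlgorithm.readings s X) :=
    hg.comp (SamplingAlgorithm.measurable_readings s)
  have hsub : {X : SampleTable n d | (SamplingAlgorithm.batch s fun y => f (g y)).run X ∈ B} ⊆
      {X | g (SamplingAlgorithm.readings s X) ∉ G} ∪
        ⋃ c ∈ Finset.univ.filter (· ∈ G), S c ∩ E c := by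
    intro X hX
    rw [Set.mem_ofPred_eq, SamplingAlgorithm.run_batch] at hX
    by_cases hG : g (SamplingAlgorithm.readings s X) ∈ G
    · right
      simp only [Set.mem_iUnion]
      exact ⟨_, by simpa using hG, rfl, hX⟩
    · exact Or.inl hG
  calc _ ≤ (sampleLaw ν).real ({X | g (SamplingAlgorithm.readings s X) ∉ G} ∪
        ⋃ c ∈ Finset.univ.filter (· ∈ G), S c ∩ E c) := measureReal_mono hsub
    _ ≤ (sampleLaw ν).real {X | g (SamplingAlgorithm.readings s X) ∉ G} +
        (sampleLaw ν).real (⋃ c ∈ Finset.univ.filter (· ∈ G), S c ∩ E c) :=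
      measureReal_union_le _ _
    _ ≤ p + ∑ c ∈ Finset.univ.filter (· ∈ G), (sampleLaw ν).real (S c ∩ E c) :=
      add_le_add h1 (measureReal_biUnion_finset_le _ _)
    _ ≤ p + ∑ c ∈ Finset.univ.filter (· ∈ G), (sampleLaw ν).real (S c) * p' := by
      gcongr with c hc
      rw [indep_readings_shift ν s hg (measurableSet_singleton c)
        ((hf c).measurableSet_run_mem B)]
      exact mul_le_mul_of_nonneg_left (h2 c (by simpa using hc)) measureReal_nonneg
    _ ≤ p + ∑ c, (sampleLaw ν).real (S c) * p' := by
      gcongr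
      exact Finset.subset_univ _
    _ = p + p' := by
      rw [← Finset.sum_mul]
      have : ∑ c, (sampleLaw ν).real (S c) = 1 := by
        have := sum_measureReal_preimage_singleton (μ := sampleLaw ν) (Finset.univ : Finset β)
          (f := fun X => g (SamplingAlgorithm.readings s X))
          (fun c _ => hmg (measurableSet_singleton c))
        rw [Finset.coe_univ, Set.preimage_univ, probReal_univ] at this
        exact this
      rw [this, one_mul]

end Law

/-! ### Concentration and rounding of the empirical means. -/

section Estimates

variable {n d : ℕ} (ν : Fin n → Measure (Fin d → unitInterval)) [∀ a, IsProbabilityMeasure (ν a)]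

lemma weight_mem_Icc (a : Fin n) (j : Fin d) : weight ν a j ∈ Set.Icc (0 : ℝ) 1 := by
  have hb : ∀ x : Fin d → unitInterval, (x j : ℝ) ∈ Set.Icc (0 : ℝ) 1 := fun x => (x j).2
  have hint : Integrable (fun x : Fin d → unitInterval => (x j : ℝ)) (ν a) :=
    Integrable.of_mem_Icc 0 1 (Measurable.aemeasurable (by fun_prop)) (ae_of_all _ hb)
  refine ⟨integral_nonneg fun x => (hb x).1, ?_⟩
  calc weight ν a j ≤ ∫ _, (1 : ℝ) ∂(ν a) :=
        integral_mono hint (integrable_const _) fun x => (hb x).2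
    _ = 1 := by simp

lemma integral_entry (t : ℕ) (a : Fin n) (j : Fin d) :
    ∫ X : SampleTable n d, (X t a j : ℝ) ∂(sampleLaw ν) = weight ν a j := by
  rw [weight, ← map_entry_sampleLaw ν t a, integral_map
    (Measurable.aemeasurable (by fun_prop)) (Measurable.aestronglyMeasurable (by fun_prop))]

/-- Two-sided Hoeffding bound. Injectivity of `e` places the samples in distinct, hence independent,
rows. -/
lemma measureReal_entries_deviation_le {m : ℕ} (e : Fin m → ℕ) (he : Function.Injective e)
    (a : Fin n) (j : Fin d) (u : ℝ) (hu : 0 ≤ u) :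
    (sampleLaw ν).real {X | u < |∑ i, (X (e i) a j : ℝ) - m * weight ν a j|} ≤
      2 * Real.exp (-(2 * u ^ 2 / m)) := by
  have hind : iIndepFun (fun (i : Fin m) (X : SampleTable n d) =>
      (X (e i) a j : ℝ) - weight ν a j) (sampleLaw ν) :=
    ((iIndepFun_rows ν).precomp he).comp
      (fun _ x => (x a j : ℝ) - weight ν a j) fun _ => by fun_prop
  have hsub : ∀ i : Fin m, HasSubgaussianMGF (fun X : SampleTable n d =>
      (X (e i) a j : ℝ) - weight ν a j) ((‖(1 : ℝ) - 0‖₊ / 2) ^ 2) (sampleLaw ν) := by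
    intro i
    have := hasSubgaussianMGF_of_mem_Icc (μ := sampleLaw ν) (a := 0) (b := 1)
      (X := fun X : SampleTable n d => (X (e i) a j : ℝ)) (Measurable.aemeasurable (by fun_prop))
      (ae_of_all _ fun X => (X (e i) a j).2)
    rwa [integral_entry] at this
  have hc : ∀ v : ℝ, -v ^ 2 / (2 * ((∑ _i : Fin m, (‖(1 : ℝ) - 0‖₊ / 2) ^ 2 : NNReal) : ℝ)) =
      -(2 * v ^ 2 / m) := by
    intro v
    rcases eq_or_ne (m : ℝ) 0 with h | h
    -- For `m = 0` both sides vanish, since division by zero gives zero.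
    · have : m = 0 := by exact_mod_cast h
      subst this
      simp
    · simp
      field_simp
  have h1 := HasSubgaussianMGF.measure_sum_ge_le_of_iIndepFun hind (s := Finset.univ)
    (fun i _ => hsub i) hu
  have hind2 : iIndepFun (fun (i : Fin m) (X : SampleTable n d) =>
      -((X (e i) a j : ℝ) - weight ν a j)) (sampleLaw ν) :=
    hind.comp (fun _ x => -x) fun _ => by fun_prop
  have h2 := HasSubgaussianMGF.measure_sum_ge_le_of_iIndepFun hind2 (s := Finset.univ)
    (fun i _ => (hsub i).neg) hu
  rw [hc] at h1 h2
  refine (measureReal_mono (s₂ := {X : SampleTable n d |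
      u ≤ ∑ i, ((X (e i) a j : ℝ) - weight ν a j)} ∪
      {X | u ≤ ∑ i, -((X (e i) a j : ℝ) - weight ν a j)}) ?_).trans ?_
  · intro X hX
    simp only [Set.mem_ofPred_eq, Set.mem_union, Finset.sum_neg_distrib, Finset.sum_sub_distrib,
      Finset.sum_const, Finset.card_univ, Fintype.card_fin, nsmul_eq_mul] at hX ⊢
    exact lt_abs.1 hX |>.imp le_of_lt le_of_lt
  · refine (measureReal_union_le _ _).trans ?_
    linarith

/-- Pull each arm of `S` in `m` consecutive rounds. -/
def schedule (S : Finset (Fin n)) (m : ℕ) : Fin (S.card * m) → Fin n :=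
  fun t => (S.equivFin.symm (finProdFinEquiv.symm t).1 : Fin n)

/-- The sum of the samples of arm `a` when the arms of `S` are pulled according to
`schedule S m`. -/
def sampleSum (S : Finset (Fin n)) (m : ℕ) (y : Fin (S.card * m) → Fin d → unitInterval)
    (a : Fin n) (j : Fin d) : ℝ :=
  if h : a ∈ S then ∑ i : Fin m, (y (finProdFinEquiv (S.equivFin ⟨a, h⟩, i)) j : ℝ) else 0

/-- The cell of the grid of width `1 / k` that contains the empirical mean of arm `a`. -/
def empiricalCell (S : Finset (Fin n)) (m k : ℕ) (y : Fin (S.card * m) → Fin d → unitInterval)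
    (a : Fin n) (j : Fin d) : Fin (k + 1) :=
  ⟨min k ⌊k * (sampleSum S m y a j / m)⌋₊, Nat.lt_succ_of_le (min_le_left _ _)⟩

/-- The cell of the grid of width `1 / k` that contains the weight of arm `a`. -/
def trueCell (k : ℕ) (a : Fin n) (j : Fin d) : Fin (k + 1) :=
  ⟨min k ⌊k * weight ν a j⌋₊, Nat.lt_succ_of_le (min_le_left _ _)⟩

lemma measurable_empiricalCell (S : Finset (Fin n)) (m k : ℕ) :
    Measurable (empiricalCell (d := d) S m k) := by
  refine measurable_pi_lambda _ fun a => measurable_pi_lambda _ fun j => ?_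
  have h : Measurable fun y : Fin (S.card * m) → Fin d → unitInterval =>
      (k : ℝ) * (sampleSum S m y a j / m) := by
    unfold sampleSum
    split_ifs
    · fun_prop
    · fun_prop
  exact (measurable_of_countable fun i : ℕ =>
    (⟨min k i, Nat.lt_succ_of_le (min_le_left _ _)⟩ : Fin (k + 1))).comp
      (Nat.measurable_floor.comp h)

/-- The cell `c` is an accurate estimate of the vector `w`. -/
def IsAccurate (k : ℕ) (w : Fin d → ℝ) (c : Fin d → Fin (k + 1)) : Prop :=
  ∀ j, ((c j : ℕ) : ℝ) / k ≤ w j + 1 / k ∧ w j ≤ ((c j : ℕ) : ℝ) / k + 2 / k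

lemma floor_cell_bounds {k : ℕ} (hk : 0 < k) {x : ℝ} (hx : x ∈ Set.Icc (0 : ℝ) 1) :
    ((min k ⌊k * x⌋₊ : ℕ) : ℝ) / k ≤ x ∧ x < ((min k ⌊k * x⌋₊ : ℕ) : ℝ) / k + 1 / k := by
  have hk' : (0 : ℝ) < k := by exact_mod_cast hk
  have h0 : 0 ≤ k * x := mul_nonneg hk'.le hx.1
  have hle : ⌊k * x⌋₊ ≤ k := by
    have : ⌊k * x⌋₊ ≤ ⌊(k : ℝ)⌋₊ := Nat.floor_mono (by nlinarith [hx.2])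
    simpa using this
  rw [min_eq_right hle]
  constructor
  · rw [div_le_iff₀ hk']
    linarith [Nat.floor_le h0]
  · rw [← add_div, lt_div_iff₀ hk']
    linarith [Nat.lt_floor_add_one (k * x)]

lemma weight_le_of_trueCell_eq {k : ℕ} (hk : 0 < k) {a b : Fin n}
    (h : trueCell ν k a = trueCell ν k b) (j : Fin d) :
    weight ν b j ≤ weight ν a j + 1 / k := by
  have h1 := floor_cell_bounds hk (weight_mem_Icc ν a j)
  have h2 := floor_cell_bounds hk (weight_mem_Icc ν b j)
  have h3 : min k ⌊k * weight ν a j⌋₊ = min k ⌊k * weight ν b j⌋₊ :=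
    congrArg Fin.val (congrFun h j)
  rw [h3] at h1
  linarith

/-- Hoeffding with deviation `1 / k` of the mean, and a union bound over coordinates. Rounding only
goes down, by less than `1 / k`, whence the asymmetric errors `1 / k` and `2 / k` in `IsAccurate`.
-/
lemma measureReal_not_isAccurate_le {S : Finset (Fin n)} {m k : ℕ} (hm : 0 < m) (hk : 0 < k)
    {a : Fin n} (ha : a ∈ S) :
    (sampleLaw ν).real {X | ¬ IsAccurate k (weight ν a)
        (empiricalCell S m k (SamplingAlgorithm.readings (schedule S m) X) a)} ≤
      d * (2 * Real.exp (-(2 * m / k ^ 2))) := by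
  have hk' : (0 : ℝ) < k := by exact_mod_cast hk
  have hm' : (0 : ℝ) < m := by exact_mod_cast hm
  set e : Fin m → ℕ := fun i => (finProdFinEquiv (S.equivFin ⟨a, ha⟩, i) : Fin (S.card * m)) with he
  have heinj : Function.Injective e := by
    intro i i' h
    have := finProdFinEquiv.injective (Fin.ext h)
    exact (Prod.ext_iff.1 this).2
  have hsum : ∀ (X : SampleTable n d) (j : Fin d),
      sampleSum S m (SamplingAlgorithm.readings (schedule S m) X) a j =
        ∑ i, (X (e i) a j : ℝ) := by
    intro X j
    simp [sampleSum, ha, SamplingAlgorithm.readings, schedule, he]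
  have hsub : {X : SampleTable n d | ¬ IsAccurate k (weight ν a)
        (empiricalCell S m k (SamplingAlgorithm.readings (schedule S m) X) a)} ⊆
      ⋃ j ∈ (Finset.univ : Finset (Fin d)),
        {X | (m : ℝ) / k < |∑ i, (X (e i) a j : ℝ) - m * weight ν a j|} := by
    intro X hX
    by_contra hcon
    simp only [Finset.mem_univ, Set.iUnion_true, Set.mem_iUnion, Set.mem_ofPred_eq, not_exists,
      not_lt] at hcon
    refine hX fun j => ?_
    have hj := hcon j
    set x : ℝ := (∑ i, (X (e i) a j : ℝ)) / m with hx
    have hxs : ∑ i, (X (e i) a j : ℝ) = m * x := by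
      rw [hx]
      field_simp
    have hxI : x ∈ Set.Icc (0 : ℝ) 1 := by
      constructor
      · exact div_nonneg (Finset.sum_nonneg fun i _ => (X (e i) a j).2.1) hm'.le
      · rw [hx, div_le_one hm']
        calc ∑ i, (X (e i) a j : ℝ) ≤ ∑ _i : Fin m, (1 : ℝ) :=
              Finset.sum_le_sum fun i _ => (X (e i) a j).2.2
          _ = m := by simp
    have hcell : ((empiricalCell S m k (SamplingAlgorithm.readings (schedule S m) X) a j : ℕ) : ℝ)
        = ((min k ⌊k * x⌋₊ : ℕ) : ℝ) := by
      simp only [empiricalCell, hsum, hx]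
    have hb := floor_cell_bounds hk hxI
    rw [hcell]
    rw [hxs, ← mul_sub, abs_mul, abs_of_pos hm', div_eq_mul_one_div, mul_le_mul_iff_right₀ hm',
      abs_le] at hj
    have : (2 : ℝ) / k = 1 / k + 1 / k := by ring
    constructor <;> linarith [hj.1, hj.2, hb.1, hb.2]
  calc _ ≤ _ := measureReal_mono hsub (measure_ne_top _ _)
    _ ≤ ∑ j : Fin d, (sampleLaw ν).real
        {X | (m : ℝ) / k < |∑ i, (X (e i) a j : ℝ) - m * weight ν a j|} :=
      measureReal_biUnion_finset_le _ _
    _ ≤ ∑ _j : Fin d, 2 * Real.exp (-(2 * m / k ^ 2)) := by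
      refine Finset.sum_le_sum fun j _ => ?_
      refine (measureReal_entries_deviation_le ν e heinj a j _ (by positivity)).trans (le_of_eq ?_)
      congr 3
      field_simp
    _ = _ := by simp

end Estimates

/-! ### Nearest representatives of groups. -/

section Selection

lemma exists_subset_smallest {α : Type*} (f : α → ℝ) (Q : Finset α) (t : ℕ) :
    ∃ R ⊆ Q, R.card ≤ t ∧ ∀ b ∈ Q, b ∉ R → R.card = t ∧ ∀ a ∈ R, f a ≤ f b := by
  classical
  induction t with
  | zero => exact ⟨∅, by simp, by simp, by simp⟩
  | succ t ih =>
    obtain ⟨R, hR, hcard, hle⟩ := ih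
    rcases (Q \ R).eq_empty_or_nonempty with h | h
    · refine ⟨R, hR, by omega, fun b hb hbR => ?_⟩
      have : b ∈ Q \ R := Finset.mem_sdiff.2 ⟨hb, hbR⟩
      simp [h] at this
    · obtain ⟨c, hc, hmin⟩ := Finset.exists_min_image (Q \ R) f h
      rw [Finset.mem_sdiff] at hc
      refine ⟨insert c R, Finset.insert_subset hc.1 hR, ?_, fun b hb hbR => ?_⟩
      · rw [Finset.card_insert_of_notMem hc.2]
        omega
      · rw [Finset.mem_insert, not_or] at hbR
        refine ⟨?_, fun a ha => ?_⟩
        · rw [Finset.card_insert_of_notMem hc.2, (hle b hb hbR.2).1]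
        · rcases Finset.mem_insert.1 ha with rfl | ha
          · exact hmin b (Finset.mem_sdiff.2 ⟨hb, hbR.2⟩)
          · exact (hle b hb hbR.2).2 a ha

/-- Used twice: with estimated cells, to define the surviving arms, and with true cells and `t = 1`,
to define the set `D` of the analysis. -/
lemma exists_representatives {α Γ C : Type*} [Fintype C] (S : Finset α) (groups : Finset Γ)
    (mem : Γ → α → Prop) (key : Γ → α → ℝ) (g : α → C) (t : ℕ) :
    ∃ S' ⊆ S, S'.card ≤ groups.card * Fintype.card C * t ∧
      ∀ γ ∈ groups, ∀ b ∈ S, mem γ b → b ∈ S' ∨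
        ∃ R ⊆ S', R.card = t ∧ ∀ a ∈ R, mem γ a ∧ key γ a ≤ key γ b ∧ g a = g b := by
  classical
  choose R hsub hcard hR using fun x : Γ × C =>
    exists_subset_smallest (key x.1) (S.filter fun a => mem x.1 a ∧ g a = x.2) t
  refine ⟨(groups ×ˢ Finset.univ).biUnion R, ?_, ?_, fun γ hγ b hb hm => ?_⟩
  · exact Finset.biUnion_subset.2 fun x _ => (hsub x).trans (Finset.filter_subset _ _)
  · refine (Finset.card_biUnion_le_card_mul _ _ t fun x _ => hcard x).trans ?_
    rw [Finset.card_product, Finset.card_univ]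
  · have hsub' : R (γ, g b) ⊆ (groups ×ˢ Finset.univ).biUnion R :=
      Finset.subset_biUnion_of_mem R (by simp [hγ])
    by_cases hbR : b ∈ R (γ, g b)
    · exact Or.inl (hsub' hbR)
    · obtain ⟨h1, h2⟩ := hR (γ, g b) b (by simp [hb, hm]) hbR
      refine Or.inr ⟨_, hsub', h1, fun a ha => ?_⟩
      have := Finset.mem_filter.1 (hsub _ ha)
      exact ⟨this.2.1, h2 a ha, this.2.2⟩

end Selection

/-! ### Covering sets of arms, their reduction, and the empirical front. -/

section Covering

variable {n d q : ℕ}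

/-- In every query interval, each arm is dominated up to `γ` by an arm of `S`. -/
def Covers (w : Fin n → Fin d → ℝ) (p : Fin n → ℝ) (l r : Fin q → ℝ) (S : Finset (Fin n))
    (γ : ℝ) : Prop :=
  ∀ i, ∀ b ∈ armsIn p (l i) (r i), ∃ a ∈ S, a ∈ armsIn p (l i) (r i) ∧ ∀ j, w b j - γ ≤ w a j

/-- The arm `a` lies on the side `x.2` of the point `x.1`. -/
def OnSide (p : Fin n → ℝ) (x : ℝ × Bool) (a : Fin n) : Prop :=
  if x.2 then x.1 ≤ p a else p a ≤ x.1

/-- The point of `a` lies between `e` and the point of `b`, and both of these lie in the interval.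
-/
lemma mem_armsIn_of_onSide {p : Fin n → ℝ} {l r e : ℝ} (hl : l < e) (hr : e < r) {s : Bool}
    {a b : Fin n} (ha : OnSide p (e, s) a) (hb : OnSide p (e, s) b) (hab : |p a - e| ≤ |p b - e|)
    (hbI : b ∈ armsIn p l r) : a ∈ armsIn p l r := by
  obtain ⟨h1, h2⟩ := hbI
  cases s with
  | true =>
    simp only [OnSide, if_true] at ha hb
    rw [abs_of_nonneg (by linarith), abs_of_nonneg (by linarith)] at hab
    exact ⟨by linarith, by linarith⟩
  | false =>
    simp only [OnSide, Bool.false_eq_true, if_false] at ha hb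
    rw [abs_of_nonpos (by linarith), abs_of_nonpos (by linarith)] at hab
    exact ⟨by linarith, by linarith⟩

/-- Given estimates of the weights, one can select few arms of `S` that still cover, provided that
few estimates are wrong and that those of a small set of arms, not depending on the estimates, are
correct. -/
lemma exists_reduction (p : Fin n → ℝ) {l r : Fin q → ℝ} {H : Finset ℝ} (hH : IsHittingSet l r H)
    (S : Finset (Fin n)) {k : ℕ} (hk : 0 < k) (t : ℕ) :
    ∃ red : (Fin n → Fin d → Fin (k + 1)) → Finset (Fin n),
      (∀ c, (red c).card ≤ 2 * H.card * (k + 1) ^ d * t) ∧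
      ∀ (ν : Fin n → Measure (Fin d → unitInterval)) [∀ a, IsProbabilityMeasure (ν a)],
        ∃ D ⊆ S, D.card ≤ 2 * H.card * (k + 1) ^ d ∧
          ∀ c, (∀ a ∈ D, IsAccurate k (weight ν a) (c a)) →
            (∀ R ⊆ S, R.card = t → ∃ a ∈ R, IsAccurate k (weight ν a) (c a)) →
            ∀ γ, Covers (weight ν) p l r S γ →
              Covers (weight ν) p l r (red c) (γ + 4 / k) := by
  classical
  set groups : Finset (ℝ × Bool) := H ×ˢ Finset.univ with hgr
  have hcard : groups.card * Fintype.card (Fin d → Fin (k + 1)) = 2 * H.card * (k + 1) ^ d := by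
    simp [hgr, mul_comm]
  choose red hsub hredcard hred using fun c : Fin n → Fin d → Fin (k + 1) =>
    exists_representatives S groups (OnSide p) (fun x a => |p a - x.1|) c t
  refine ⟨red, fun c => hcard ▸ hredcard c, fun ν _ => ?_⟩
  -- `D` is built from the true weights, before the estimates `c` are introduced; this makes a union
  -- bound over `D` legitimate.
  obtain ⟨D, hDS, hDcard, hD⟩ :=
    exists_representatives S groups (OnSide p) (fun x a => |p a - x.1|) (trueCell ν k) 1
  rw [mul_one, hcard] at hDcard
  refine ⟨D, hDS, hDcard, fun c hacc hfew γ hcov i b hb => ?_⟩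
  have hk' : (0 : ℝ) < 1 / k := by positivity
  obtain ⟨b', hb'S, hb'I, hb'⟩ := hcov i b hb
  obtain ⟨e, heH, hle, her⟩ := hH i
  obtain ⟨s, hs⟩ : ∃ s : Bool, OnSide p (e, s) b' := by
    rcases le_total e (p b') with h | h
    · exact ⟨true, by simpa [OnSide] using h⟩
    · exact ⟨false, by simpa [OnSide] using h⟩
  have hg : (e, s) ∈ groups := by simp [hgr, heH]
  obtain ⟨x, hxD, hxs, hxkey, hxw⟩ : ∃ x ∈ D, OnSide p (e, s) x ∧ |p x - e| ≤ |p b' - e| ∧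
      ∀ j, weight ν b' j ≤ weight ν x j + 1 / k := by
    rcases hD _ hg b' hb'S hs with h | ⟨R, hRD, hR1, hR⟩
    · exact ⟨b', h, hs, le_rfl, fun j => by linarith⟩
    · obtain ⟨x, rfl⟩ := Finset.card_eq_one.1 hR1
      obtain ⟨h1, h2, h3⟩ := hR x (by simp)
      exact ⟨x, hRD (by simp), h1, h2, weight_le_of_trueCell_eq ν hk h3⟩
  have hxI := mem_armsIn_of_onSide hle her hxs hs hxkey hb'I
  have h4 : (4 : ℝ) / k = 1 / k + 1 / k + 2 / k := by ring
  have h2 : (2 : ℝ) / k = 1 / k + 1 / k := by ring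
  -- Passing from `b'` to `x` costs `1 / k` (same true cell). Passing from `x` to `a` costs `2 / k +
  -- 1 / k` (same estimate, both accurate).
  rcases hred c _ hg x (hDS hxD) hxs with h | ⟨R, hRS, hRt, hR⟩
  · exact ⟨x, h, hxI, fun j => by linarith [hb' j, hxw j]⟩
  · obtain ⟨a, haR, ha⟩ := hfew R (hRS.trans (hsub c)) hRt
    obtain ⟨has, hakey, hac⟩ := hR a haR
    refine ⟨a, hRS haR, mem_armsIn_of_onSide hle her has hxs hakey hxI, fun j => ?_⟩
    have h5 := (ha j).1
    rw [hac] at h5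
    linarith [hb' j, hxw j, (hacc x hxD j).2]

/-- The arms of `S` in the query intervals that are not dominated with margin `ε / 2` according to
the estimates `c`. -/
def empiricalFront (p : Fin n → ℝ) (l r : Fin q → ℝ) (ε : ℝ) (S : Finset (Fin n)) {k : ℕ}
    (c : Fin n → Fin d → Fin (k + 1)) (i : Fin q) : Finset (Fin n) := by
  classical
  exact S.filter fun a => a ∈ armsIn p (l i) (r i) ∧ ∀ b ∈ S, b ∈ armsIn p (l i) (r i) →
    ¬ ∀ j, ((c a j : ℕ) : ℝ) / k + ε / 2 ≤ ((c b j : ℕ) : ℝ) / k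

/-- Comparing two estimates costs at most `3 / k ≤ 3 * ε / 32` and covering costs `ε / 4`. An arm
beaten by `ε` is thus seen to be beaten by more than `ε / 2` by an arm of `S` and is discarded,
while the loss in the covering condition stays below `ε`. -/
lemma isParetoOptimal_empiricalFront (hd : 1 ≤ d) {w : Fin n → Fin d → ℝ} {p : Fin n → ℝ}
    {l r : Fin q → ℝ} {ε : ℝ} (hε : 0 < ε) {S : Finset (Fin n)} {k : ℕ} (hkε : 32 / ε ≤ k)
    {c : Fin n → Fin d → Fin (k + 1)} (hacc : ∀ a ∈ S, IsAccurate k (w a) (c a))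
    (hcov : Covers w p l r S (ε / 4)) (i : Fin q) :
    IsParetoOptimal w p (l i) (r i) ε (empiricalFront p l r ε S c i) := by
  classical
  have hk : (0 : ℝ) < k := lt_of_lt_of_le (by positivity) hkε
  have hη : 1 / (k : ℝ) ≤ ε / 32 := by
    rw [div_le_iff₀ hε] at hkε
    rw [div_le_div_iff₀ hk (by norm_num)]
    linarith
  have h2 : (2 : ℝ) / k = 1 / k + 1 / k := by ring
  have : NeZero d := ⟨by omega⟩
  refine ⟨fun a ha => ?_, fun b hb => ?_, ?_⟩
  · exact (Finset.mem_filter.1 ha).2.1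
  · obtain ⟨b', hb'S, hb'I, hb'⟩ := hcov i b hb
    set Q := S.filter fun a => a ∈ armsIn p (l i) (r i) ∧
      ∀ j, ((c b' j : ℕ) : ℝ) / k ≤ ((c a j : ℕ) : ℝ) / k with hQ
    -- Domination with margin `ε / 2` is transitive and strictly raises coordinate `0`, so a
    -- maximizer of that coordinate above `b'` is undominated. Here `d ≥ 1` enters.
    obtain ⟨a, haQ, hmax⟩ := Finset.exists_max_image Q (fun a => ((c a 0 : ℕ) : ℝ) / k)
      ⟨b', by simp [hQ, hb'S, hb'I]⟩
    obtain ⟨haS, haI, hab⟩ := Finset.mem_filter.1 haQ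
    refine ⟨a, Finset.mem_filter.2 ⟨haS, haI, fun x hxS hxI hx => ?_⟩, fun j => ?_⟩
    · have hxQ : x ∈ Q := Finset.mem_filter.2 ⟨hxS, hxI, fun j => by
        linarith [hab j, hx j]⟩
      linarith [hmax x hxQ, hx 0]
    · simp only [Pi.sub_apply]
      linarith [hb' j, hab j, (hacc a haS j).1, (hacc b' hb'S j).2]
  · rintro a ha ⟨b, hb, hab⟩
    obtain ⟨haS, haI, hnd⟩ := Finset.mem_filter.1 ha
    obtain ⟨b', hb'S, hb'I, hb'⟩ := hcov i b hb
    refine hnd b' hb'S hb'I fun j => ?_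
    have := hab j
    simp only [Pi.add_apply] at this
    linarith [hb' j, (hacc a haS j).1, (hacc b' hb'S j).2]

end Covering

/-! ### Markov and union bounds for families of bad events. -/

section Events

/-- Markov's inequality for the number of events `E a` that occur; no independence between arms is
needed. -/
lemma measureReal_forall_mem_le {Ω ι : Type*} [MeasurableSpace Ω] (μ : Measure Ω)
    [IsProbabilityMeasure μ] (S : Finset ι) {E : ι → Set Ω} (hE : ∀ a ∈ S, MeasurableSet (E a))
    {x : ℝ} (hx : ∀ a ∈ S, μ.real (E a) ≤ x) (t : ℕ) :
    t * μ.real {ω | ∃ R ⊆ S, R.card = t ∧ ∀ a ∈ R, ω ∈ E a} ≤ S.card * x := by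
  classical
  set f : Ω → ℝ := fun ω => ∑ a ∈ S, (E a).indicator 1 ω with hf
  have hint : ∀ a ∈ S, Integrable ((E a).indicator (1 : Ω → ℝ)) μ := fun a ha =>
    (integrable_const (1 : ℝ)).indicator (hE a ha)
  have hnn : ∀ ω a, 0 ≤ (E a).indicator (1 : Ω → ℝ) ω := fun ω a =>
    Set.indicator_nonneg (fun _ _ => zero_le_one) ω
  have hmarkov := mul_meas_ge_le_integral_of_nonneg (μ := μ) (f := f)
    (ae_of_all _ fun ω => Finset.sum_nonneg fun a _ => hnn ω a)
    (integrable_finsetSum _ hint) t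
  have hsub : {ω | ∃ R ⊆ S, R.card = t ∧ ∀ a ∈ R, ω ∈ E a} ⊆ {ω | (t : ℝ) ≤ f ω} := by
    rintro ω ⟨R, hRS, hRt, hR⟩
    calc (t : ℝ) = ∑ a ∈ R, (E a).indicator (1 : Ω → ℝ) ω := by
          rw [Finset.sum_congr rfl fun a ha => Set.indicator_of_mem (hR a ha) _]
          simp [hRt]
      _ ≤ f ω := Finset.sum_le_sum_of_subset_of_nonneg hRS fun a _ _ => hnn ω a
  calc _ ≤ t * μ.real {ω | (t : ℝ) ≤ f ω} :=
        mul_le_mul_of_nonneg_left (measureReal_mono hsub) (Nat.cast_nonneg t)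
    _ ≤ ∫ ω, f ω ∂μ := hmarkov
    _ = ∑ a ∈ S, μ.real (E a) := by
      rw [hf, integral_finsetSum _ hint]
      exact Finset.sum_congr rfl fun a ha => integral_indicator_one (hE a ha)
    _ ≤ ∑ _a ∈ S, x := Finset.sum_le_sum hx
    _ = S.card * x := by simp

lemma measureReal_exists_mem_le {Ω ι : Type*} [MeasurableSpace Ω] (μ : Measure Ω)
    [IsProbabilityMeasure μ] (S : Finset ι) {E : ι → Set Ω}
    {x : ℝ} (hx : ∀ a ∈ S, μ.real (E a) ≤ x) :
    μ.real {ω | ∃ a ∈ S, ω ∈ E a} ≤ S.card * x := by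
  have : {ω | ∃ a ∈ S, ω ∈ E a} = ⋃ a ∈ S, E a := by
    ext
    simp
  rw [this]
  refine (measureReal_biUnion_finset_le _ _).trans ?_
  calc _ ≤ ∑ _a ∈ S, x := Finset.sum_le_sum hx
    _ = S.card * x := by simp

end Events

/-! ### The phases of the elimination. -/

section Elimination

variable {n d q : ℕ}

set_option maxHeartbeats 1000000 in
/-- Batch elimination, started in phase `j` with a set `S` of arms that covers. -/
lemma exists_elimination (hd : 1 ≤ d) (p : Fin n → ℝ) {l r : Fin q → ℝ} {H : Finset ℝ}
    (hH : IsHittingSet l r H) (hHcard : 1 ≤ H.card) {ε δ : ℝ} (hε : 0 < ε) (hδ : 0 < δ) {k₀ : ℕ}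
    (hk₀ : 32 / ε ≤ k₀) {m : ℕ → ℕ} (hmpos : ∀ j, 0 < m j) {c₀ : ℝ}
    (hmle : ∀ j, (m j : ℝ) ≤ c₀ * (4 ^ j * (j + 1)))
    (hm : ∀ j, 17 * (2 * H.card * ((k₀ * 2 ^ j : ℕ) + 1) ^ d : ℝ) *
      (d * (2 * Real.exp (-(2 * m j / ((k₀ * 2 ^ j : ℕ) : ℝ) ^ 2)))) ≤ δ / 2 ^ (j + 1))
    (S : Finset (Fin n)) (j : ℕ) :
    ∃ A : SamplingAlgorithm n d (Fin q → Finset (Fin n)), A.IsMeasurable ∧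
      (∀ (ν : Fin n → Measure (Fin d → unitInterval)) [∀ a, IsProbabilityMeasure (ν a)],
        Covers (weight ν) p l r S (8 / k₀ * (1 - 1 / 2 ^ j)) →
          (sampleLaw ν).real {X | ¬ ∀ i, IsParetoOptimal (weight ν) p (l i) (r i) ε (A.run X i)} ≤
            δ / 2 ^ j) ∧
      ∀ X, (A.samplesDrawn X : ℝ) ≤ c₀ * S.card * (4 ^ j * (2 * (j + 2))) := by
  classical
  have hk₀pos : (0 : ℝ) < k₀ := lt_of_lt_of_le (by positivity) hk₀
  have hc₀ : 0 ≤ c₀ := by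
    have := hmle 0
    simp only [pow_zero, CharP.cast_eq_zero, zero_add, mul_one] at this
    exact (Nat.cast_nonneg _).trans this
  induction hN : S.card using Nat.strong_induction_on generalizing S j with
  | _ N ih =>
  subst hN
  set k : ℕ := k₀ * 2 ^ j with hk
  have hkpos : 0 < k := Nat.mul_pos (by exact_mod_cast hk₀pos) (by positivity)
  set K : ℕ := 2 * H.card * (k + 1) ^ d with hK
  have hKpos : 0 < K := Nat.mul_pos (by omega) (by positivity)
  have hKpos' : (0 : ℝ) < K := by exact_mod_cast hKpos
  set x : ℝ := d * (2 * Real.exp (-(2 * m j / (k : ℝ) ^ 2))) with hx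
  have hx0 : 0 ≤ x := by positivity
  have hKx : 17 * K * x ≤ δ / 2 ^ (j + 1) := by
    have := hm j
    rw [← hk, ← hx] at this
    rw [hK]
    push_cast
    exact this
  have hδj : δ / 2 ^ j = δ / 2 ^ (j + 1) + δ / 2 ^ (j + 1) := by
    rw [pow_succ]
    ring
  have hδj0 : 0 < δ / 2 ^ (j + 1) := by positivity
  -- The covering error is a partial geometric sum: phase `j` adds `4 / (k₀ * 2 ^ j)`.
  have hγ : (8 : ℝ) / k₀ * (1 - 1 / 2 ^ j) + 4 / k = 8 / k₀ * (1 - 1 / 2 ^ (j + 1)) := by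
    rw [hk]
    push_cast
    rw [pow_succ]
    field_simp
    ring
  set g := empiricalCell (d := d) S (m j) k with hg
  have hgm : Measurable g := measurable_empiricalCell S (m j) k
  have hbad : ∀ (ν : Fin n → Measure (Fin d → unitInterval)) [∀ a, IsProbabilityMeasure (ν a)],
      ∀ a ∈ S, (sampleLaw ν).real {X | ¬ IsAccurate k (weight ν a)
        (g (SamplingAlgorithm.readings (schedule S (m j)) X) a)} ≤ x := fun ν _ a ha =>
    measureReal_not_isAccurate_le ν (hmpos j) hkpos ha
  have hmbad : ∀ (ν : Fin n → Measure (Fin d → unitInterval)) (a : Fin n),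
      MeasurableSet {X | ¬ IsAccurate k (weight ν a)
        (g (SamplingAlgorithm.readings (schedule S (m j)) X) a)} := fun ν a =>
    (hgm.comp (SamplingAlgorithm.measurable_readings (schedule S (m j))))
      (Set.toFinite {c : Fin n → Fin d → Fin (k + 1) |
        ¬ IsAccurate k (weight ν a) (c a)}).measurableSet
  -- Below `8 * K` arms the union bound over all of `S` costs at most `8 * K * x`, within the budget
  -- `17 * K * x`; otherwise `t ≥ 1` and elimination proceeds.
  rcases lt_or_ge S.card (8 * K) with hS | hS
  · refine ⟨.batch (schedule S (m j)) fun y => .output (empiricalFront p l r ε S (g y)),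
      SamplingAlgorithm.isMeasurable_batch _ hgm (f := fun c => .output (empiricalFront p l r ε S c))
        fun _ => SamplingAlgorithm.isMeasurable_output _, fun ν _ hcov => ?_, fun X => ?_⟩
    · refine (measureReal_batch_le ν (schedule S (m j)) hgm
        (f := fun c => .output (empiricalFront p l r ε S c))
        (fun _ => SamplingAlgorithm.isMeasurable_output _)
        {c | ∀ a ∈ S, IsAccurate k (weight ν a) (c a)}
        {T | ¬ ∀ i, IsParetoOptimal (weight ν) p (l i) (r i) ε (T i)} le_rfl
        (p := δ / 2 ^ (j + 1)) ?_ ?_).trans (by linarith)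
      · have h := measureReal_exists_mem_le (sampleLaw ν) S (hbad ν)
        simp only [Set.mem_ofPred_eq, not_forall, exists_prop] at h ⊢
        have hScard : (S.card : ℝ) ≤ 8 * K := by exact_mod_cast hS.le
        nlinarith [mul_le_mul_of_nonneg_right hScard hx0, mul_nonneg hKpos'.le hx0]
      · intro c hc
        have hcov' : Covers (weight ν) p l r S (ε / 4) := by
          have h1 : (8 : ℝ) / k₀ * (1 - 1 / 2 ^ j) ≤ ε / 4 := by
            have h2 : (0 : ℝ) < 1 / 2 ^ j := by positivity
            have h3 : (8 : ℝ) / k₀ ≤ ε / 4 := by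
              rw [div_le_iff₀ hε] at hk₀
              rw [div_le_div_iff₀ hk₀pos (by norm_num)]
              linarith
            have h4 : (0 : ℝ) < 8 / k₀ := by positivity
            nlinarith
          intro i b hb
          obtain ⟨a, haS, haI, ha⟩ := hcov i b hb
          exact ⟨a, haS, haI, fun i => by linarith [ha i]⟩
        have hkε : 32 / ε ≤ k := hk₀.trans (by
          rw [hk]
          exact_mod_cast Nat.le_mul_of_pos_right _ (by positivity))
        have : {X : SampleTable n d | (SamplingAlgorithm.output (empiricalFront p l r ε S c)).run X ∈
            {T | ¬ ∀ i, IsParetoOptimal (weight ν) p (l i) (r i) ε (T i)}} = ∅ := by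
          refine Set.eq_empty_of_forall_notMem fun X hX => hX fun i => ?_
          exact isParetoOptimal_empiricalFront hd hε hkε hc hcov' i
        rw [this, measureReal_empty]
    · rw [SamplingAlgorithm.samplesDrawn_batch, SamplingAlgorithm.samplesDrawn, add_zero]
      push_cast
      calc (S.card : ℝ) * m j ≤ S.card * (c₀ * (4 ^ j * (j + 1))) := by
            gcongr
            exact hmle j
        _ = c₀ * S.card * (4 ^ j * (j + 1)) := by ring
        _ ≤ c₀ * S.card * (4 ^ j * (2 * (j + 2))) := by
            gcongr
            linarith [(Nat.cast_nonneg j : (0 : ℝ) ≤ j)]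
  · set t := S.card / (8 * K) with ht
    have htpos : 0 < t := Nat.div_pos hS (by omega)
    have hKt : 8 * (K * t) ≤ S.card := by
      calc 8 * (K * t) = 8 * K * t := by ring
        _ ≤ S.card := Nat.mul_div_le _ _
    -- Rounding down loses at most a factor `2` because `t ≥ 1`. Markov then gives `16 * K * x`, and
    -- `D` contributes `K * x`, for a total of `17 * K * x`.
    have htS : S.card ≤ 16 * K * t := by
      have h1 : S.card < 8 * K * (t + 1) := Nat.lt_mul_div_succ _ (by omega)
      nlinarith
    obtain ⟨red, hredcard, hred⟩ := exists_reduction (d := d) p hH S hkpos t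
    have hlt : ∀ c, (red c).card < S.card := fun c => by
      have := hredcard c
      rw [← hK] at this
      omega
    choose A hAm hAp hAs using fun c => ih (red c).card (hlt c) (red c) (j + 1) rfl
    refine ⟨.batch (schedule S (m j)) fun y => A (g y),
      SamplingAlgorithm.isMeasurable_batch _ hgm hAm, fun ν _ hcov => ?_, fun X => ?_⟩
    · obtain ⟨D, hDS, hDcard, hD⟩ := hred ν
      rw [hδj]
      refine measureReal_batch_le ν (schedule S (m j)) hgm hAm
        {c | (∀ a ∈ D, IsAccurate k (weight ν a) (c a)) ∧
          ∀ R ⊆ S, R.card = t → ∃ a ∈ R, IsAccurate k (weight ν a) (c a)}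
        {T | ¬ ∀ i, IsParetoOptimal (weight ν) p (l i) (r i) ε (T i)} hδj0.le ?_ ?_
      · have h1 := measureReal_exists_mem_le (sampleLaw ν) D fun a ha => hbad ν a (hDS ha)
        have h2 := measureReal_forall_mem_le (sampleLaw ν) S
          (E := fun a => {X | ¬ IsAccurate k (weight ν a)
            (g (SamplingAlgorithm.readings (schedule S (m j)) X) a)})
          (fun a _ => hmbad ν a) (hbad ν) t
        have htpos' : (0 : ℝ) < t := by exact_mod_cast htpos
        have htS' : (S.card : ℝ) ≤ 16 * K * t := by exact_mod_cast htS
        have hDcard' : (D.card : ℝ) ≤ K := by exact_mod_cast hDcard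
        have h3 : (sampleLaw ν).real {X | ∃ R ⊆ S, R.card = t ∧ ∀ a ∈ R, X ∈
            {X | ¬ IsAccurate k (weight ν a)
              (g (SamplingAlgorithm.readings (schedule S (m j)) X) a)}} ≤ 16 * K * x := by
          refine le_of_mul_le_mul_left (h2.trans ?_) htpos'
          calc (S.card : ℝ) * x ≤ 16 * K * t * x := by gcongr
            _ = t * (16 * K * x) := by ring
        refine (measureReal_mono (s₂ := _ ∪ _) ?_).trans
          ((measureReal_union_le _ _).trans ((add_le_add h1 h3).trans ?_))
        · intro X hX
          by_contra hcon
          simp only [Set.mem_ofPred_eq, Set.mem_union, not_or, not_exists, not_and, not_forall,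
            not_not, exists_prop] at hcon
          exact hX hcon
        · have : (D.card : ℝ) * x ≤ K * x := by gcongr
          linarith
      · rintro c ⟨hc1, hc2⟩
        exact hAp c ν (hγ ▸ hD c hc1 hc2 _ hcov)
    · rw [SamplingAlgorithm.samplesDrawn_batch]
      push_cast
      have h1 := hAs (g (SamplingAlgorithm.readings (schedule S (m j)) X))
        fun t => X (S.card * m j + t)
      have h2 : ((red (g (SamplingAlgorithm.readings (schedule S (m j)) X))).card : ℝ) ≤
          S.card / 8 := by
        rw [le_div_iff₀ (by norm_num)]
        have := hredcard (g (SamplingAlgorithm.readings (schedule S (m j)) X))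
        rw [← hK] at this
        exact_mod_cast (by omega : (red (g (SamplingAlgorithm.readings (schedule S (m j)) X))).card
          * 8 ≤ S.card)
      push_cast at h1
      -- The factor `2 * (j + 2)` solves the cost recursion exactly: `(j + 1) + (4 / 8) * 2 * (j +
      -- 3) = 2 * (j + 2)`.
      calc _ ≤ (S.card : ℝ) * (c₀ * (4 ^ j * (j + 1))) +
            c₀ * (S.card / 8) * (4 ^ (j + 1) * (2 * (j + 1 + 2))) := by
            refine add_le_add ?_ (h1.trans ?_)
            · gcongr
              exact hmle j
            · gcongr
        _ = c₀ * S.card * (4 ^ j * (2 * (j + 2))) := by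
            rw [pow_succ]
            ring

end Elimination

/-! ### Sample counts of the phases. -/

section Parameters

/-- Since `ε, δ ≤ 1` and `τ * d ≥ 1`, both `τ * d / δ` and `1 / ε` are at most `exp L`. The power
`(k + 1) ^ d` is what produces the factor `d`. -/
lemma log_union_bound_le {d τ : ℕ} (hd : 1 ≤ d) (hτ : 1 ≤ τ) {ε δ : ℝ} (hε : 0 < ε) (hε1 : ε ≤ 1)
    (hδ : 0 < δ) (hδ1 : δ ≤ 1) {k₀ : ℕ} (hk₀ : (k₀ : ℝ) ≤ 33 / ε) (j : ℕ) :
    Real.log (34 * d * (2 * τ * ((k₀ * 2 ^ j : ℕ) + 1) ^ d) / (δ / 2 ^ (j + 1))) ≤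
      11 * d * (j + 1) * max 1 (Real.log (τ * d / (ε * δ))) := by
  set L := max 1 (Real.log (τ * d / (ε * δ))) with hL
  have hL1 : 1 ≤ L := le_max_left _ _
  have hd' : (1 : ℝ) ≤ d := by exact_mod_cast hd
  have hτ' : (1 : ℝ) ≤ τ := by exact_mod_cast hτ
  have hj : (0 : ℝ) ≤ j := Nat.cast_nonneg j
  have hτd : (1 : ℝ) ≤ τ * d := one_le_mul_of_one_le_of_one_le hτ' hd'
  have hQ : τ * d / (ε * δ) ≤ Real.exp L := by
    rw [← Real.log_le_iff_le_exp (by positivity)]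
    exact le_max_right _ _
  have hQ1 : τ * d / δ ≤ Real.exp L := by
    refine le_trans ?_ hQ
    gcongr
    nlinarith
  have hQ2 : 1 / ε ≤ Real.exp L := by
    refine le_trans ?_ hQ
    rw [div_le_div_iff₀ hε (by positivity)]
    nlinarith [mul_pos hε hδ]
  have he1 : (2.7 : ℝ) ≤ Real.exp 1 := by linarith [Real.exp_one_gt_d9]
  have he5 : (136 : ℝ) ≤ Real.exp 5 := by
    rw [show (5 : ℝ) = (5 : ℕ) * 1 by norm_num, Real.exp_nat_mul]
    calc (136 : ℝ) ≤ 2.7 ^ 5 := by norm_num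
      _ ≤ _ := by gcongr
  have he4 : (34 : ℝ) ≤ Real.exp 4 := by
    rw [show (4 : ℝ) = (4 : ℕ) * 1 by norm_num, Real.exp_nat_mul]
    calc (34 : ℝ) ≤ 2.7 ^ 4 := by norm_num
      _ ≤ _ := by gcongr
  have hej : (2 : ℝ) ^ j ≤ Real.exp j := by
    rw [show (j : ℝ) = j * 1 by ring, Real.exp_nat_mul]
    gcongr
    linarith
  have h2j : (1 : ℝ) ≤ 2 ^ j := one_le_pow₀ (by norm_num)
  have hkj : ((k₀ * 2 ^ j : ℕ) : ℝ) + 1 ≤ Real.exp (4 + j + L) := by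
    rw [Real.exp_add, Real.exp_add]
    push_cast
    have h1 : 1 ≤ 1 / ε * 2 ^ j :=
      one_le_mul_of_one_le_of_one_le (by rwa [le_div_iff₀ hε, one_mul]) h2j
    calc (k₀ : ℝ) * 2 ^ j + 1 ≤ 33 / ε * 2 ^ j + 1 / ε * 2 ^ j := by gcongr
      _ = 34 * 2 ^ j * (1 / ε) := by ring
      _ ≤ _ := by gcongr
  have hpos : (0 : ℝ) < 34 * d * (2 * τ * ((k₀ * 2 ^ j : ℕ) + 1) ^ d) / (δ / 2 ^ (j + 1)) := by
    positivity
  rw [Real.log_le_iff_le_exp hpos]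
  calc 34 * d * (2 * τ * ((k₀ * 2 ^ j : ℕ) + 1) ^ d) / (δ / 2 ^ (j + 1))
      = 136 * 2 ^ j * (τ * d / δ) * (((k₀ * 2 ^ j : ℕ) : ℝ) + 1) ^ d := by
        rw [pow_succ]
        field_simp
        ring
    _ ≤ Real.exp 5 * Real.exp j * Real.exp L * Real.exp (4 + j + L) ^ d := by gcongr
    _ = Real.exp (5 + j + L + d * (4 + j + L)) := by
        rw [← Real.exp_nat_mul, ← Real.exp_add, ← Real.exp_add, ← Real.exp_add]
    _ ≤ Real.exp (11 * d * (j + 1) * L) := by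
        rw [Real.exp_le_exp]
        have h1 : 5 + j + L ≤ d * (5 + j + L) := le_mul_of_one_le_left (by positivity) hd'
        have h2 : 9 + 2 * j + 2 * L ≤ 11 * (j + 1) * L := by nlinarith
        calc _ ≤ (d : ℝ) * (9 + 2 * j + 2 * L) := by linarith
          _ ≤ d * (11 * (j + 1) * L) := by gcongr
          _ = _ := by ring

lemma exists_sample_counts {d τ : ℕ} (hd : 1 ≤ d) (hτ : 1 ≤ τ) {ε δ : ℝ} (hε : 0 < ε)
    (hε1 : ε ≤ 1) (hδ : 0 < δ) (hδ1 : δ ≤ 1) {k₀ : ℕ} (hk₀pos : 0 < k₀)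
    (hk₀ : (k₀ : ℝ) ≤ 33 / ε) (j : ℕ) :
    ∃ m : ℕ, 0 < m ∧
      (m : ℝ) ≤ 6000 * (d / ε ^ 2) * max 1 (Real.log (τ * d / (ε * δ))) * (4 ^ j * (j + 1)) ∧
      17 * (2 * τ * ((k₀ * 2 ^ j : ℕ) + 1) ^ d : ℝ) *
        (d * (2 * Real.exp (-(2 * m / ((k₀ * 2 ^ j : ℕ) : ℝ) ^ 2)))) ≤ δ / 2 ^ (j + 1) := by
  have hlog := log_union_bound_le hd hτ hε hε1 hδ hδ1 hk₀ j
  set L := max 1 (Real.log (τ * d / (ε * δ))) with hL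
  have hL1 : 1 ≤ L := le_max_left _ _
  have hd' : (1 : ℝ) ≤ d := by exact_mod_cast hd
  have hj : (0 : ℝ) ≤ j := Nat.cast_nonneg j
  set k : ℝ := ((k₀ * 2 ^ j : ℕ) : ℝ) with hk
  have hkpos : 0 < k := by
    rw [hk]
    exact_mod_cast Nat.mul_pos hk₀pos (by positivity)
  set x : ℝ := 34 * d * (2 * τ * (k + 1) ^ d) / (δ / 2 ^ (j + 1)) with hx
  have hnum : 0 < 34 * d * (2 * τ * (k + 1) ^ d) := by positivity
  have hxpos : 0 < x := by positivity
  have hd0 : (0 : ℝ) ≤ 11 * d * (j + 1) * L := by positivity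
  -- Chosen so that `exp (-(2 * m / k ^ 2)) ≤ x⁻¹`; the extra `1` ensures positivity.
  refine ⟨⌈k ^ 2 / 2 * Real.log x⌉₊ + 1, Nat.succ_pos _, ?_, ?_⟩
  · have hk2 : k ^ 2 ≤ 1089 / ε ^ 2 * 4 ^ j := by
      have h4 : (4 : ℝ) ^ j = (2 ^ j) ^ 2 := by
        rw [← pow_mul, mul_comm, pow_mul]
        norm_num
      rw [hk, h4]
      push_cast
      calc ((k₀ : ℝ) * 2 ^ j) ^ 2 ≤ (33 / ε * 2 ^ j) ^ 2 := by gcongr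
        _ = _ := by ring
    have hone : 1 ≤ d / ε ^ 2 * L * (4 ^ j * (j + 1)) := by
      have h1 : 1 ≤ d / ε ^ 2 := by
        rw [le_div_iff₀ (by positivity)]
        nlinarith
      have h2 : (1 : ℝ) ≤ 4 ^ j := one_le_pow₀ (by norm_num)
      exact one_le_mul_of_one_le_of_one_le (one_le_mul_of_one_le_of_one_le h1 hL1)
        (one_le_mul_of_one_le_of_one_le h2 (by linarith))
    have hceil : (⌈k ^ 2 / 2 * Real.log x⌉₊ : ℝ) ≤
        1089 / ε ^ 2 * 4 ^ j / 2 * (11 * d * (j + 1) * L) + 1 := by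
      calc (⌈k ^ 2 / 2 * Real.log x⌉₊ : ℝ) ≤
            (⌈1089 / ε ^ 2 * 4 ^ j / 2 * (11 * d * (j + 1) * L)⌉₊ : ℝ) := by
            refine Nat.cast_le.2 (Nat.ceil_mono ?_)
            exact (mul_le_mul_of_nonneg_left hlog (by positivity)).trans (by gcongr)
        _ ≤ _ := (Nat.ceil_lt_add_one (by positivity)).le
    push_cast
    calc _ ≤ 1089 / ε ^ 2 * 4 ^ j / 2 * (11 * d * (j + 1) * L) + 1 + 1 := by linarith
      -- `5989.5 = 33 ^ 2 * 11 / 2`; the remaining `2` is absorbed because the bracket is at least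
      -- `1`.
      _ = 5989.5 * (d / ε ^ 2 * L * (4 ^ j * (j + 1))) + 2 := by ring
      _ ≤ 6000 * (d / ε ^ 2 * L * (4 ^ j * (j + 1))) := by linarith
      _ = _ := by ring
  · have hexp : Real.exp (-(2 * (⌈k ^ 2 / 2 * Real.log x⌉₊ + 1 : ℕ) / k ^ 2)) ≤ x⁻¹ := by
      rw [Real.exp_neg]
      gcongr
      rw [← Real.log_le_iff_le_exp hxpos, le_div_iff₀ (by positivity)]
      have := Nat.le_ceil (k ^ 2 / 2 * Real.log x)
      push_cast
      linarith
    calc _ ≤ 17 * (2 * τ * (k + 1) ^ d : ℝ) * (d * (2 * x⁻¹)) := by gcongr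
      _ = 34 * d * (2 * τ * (k + 1) ^ d) * x⁻¹ := by ring
      _ = δ / 2 ^ (j + 1) := by
        rw [hx, inv_div, mul_div_cancel₀ _ hnum.ne']

end Parameters

/-! ### Choice of parameters and the degenerate cases. -/

section Existence

lemma exists_isHittingSet_card_eq {q : ℕ} {l r : Fin q → ℝ} (hlr : ∀ i, l i < r i) :
    ∃ H : Finset ℝ, IsHittingSet l r H ∧ H.card = hittingNumber l r := by
  classical
  refine Nat.sInf_mem (s := {k | ∃ H : Finset ℝ, IsHittingSet l r H ∧ H.card = k})
    ⟨_, Finset.univ.image fun i => (l i + r i) / 2, fun i => ?_, rfl⟩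
  refine ⟨(l i + r i) / 2, Finset.mem_image_of_mem _ (Finset.mem_univ i), ?_, ?_⟩ <;>
    linarith [hlr i]

lemma exists_isCorrectOn {n d q : ℕ} (p : Fin n → ℝ) (l r : Fin q → ℝ) (ε δ : ℝ) (hd : 1 ≤ d)
    (hq : 1 ≤ q) (hlr : ∀ i, l i < r i) (hε : 0 < ε) (hδ : 0 < δ) :
    ∃ A : SamplingAlgorithm n d (Fin q → Finset (Fin n)), IsCorrectOn p l r ε δ A ∧
      ∀ X, (A.samplesDrawn X : ℝ) ≤ 24000 * ((n : ℝ) * (d : ℝ) / ε ^ 2) *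
        max 1 (Real.log ((hittingNumber l r : ℝ) * (d : ℝ) / (ε * δ))) := by
  classical
  have hbound : 0 ≤ 24000 * ((n : ℝ) * (d : ℝ) / ε ^ 2) *
        max 1 (Real.log ((hittingNumber l r : ℝ) * (d : ℝ) / (ε * δ))) := by positivity
  -- Weights lie in `[0, 1]`, so for `ε > 1` no arm beats another by `ε` and returning all arms
  -- needs no samples. For `δ > 1` nothing is required of the output.
  rcases lt_or_ge 1 ε with hε1 | hε1
  · refine ⟨.output fun i => Finset.univ.filter (· ∈ armsIn p (l i) (r i)),
      ⟨SamplingAlgorithm.isMeasurable_output _, fun ν _ => ?_⟩, fun X => by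
        simpa [SamplingAlgorithm.samplesDrawn] using hbound⟩
    have : {X : SampleTable n d | ∀ i, IsParetoOptimal (weight ν) p (l i) (r i) ε
        ((SamplingAlgorithm.output (n := n) (d := d) fun i : Fin q =>
          Finset.univ.filter (· ∈ armsIn p (l i) (r i))).run X i)} = Set.univ := by
      refine Set.eq_univ_of_forall fun X i => ⟨fun a ha => (Finset.mem_filter.1 ha).2,
        fun b hb => ⟨b, Finset.mem_filter.2 ⟨Finset.mem_univ b, hb⟩, fun j => ?_⟩, ?_⟩
      · simp [hε.le]
      · rintro a _ ⟨b, _, hab⟩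
        have := hab ⟨0, hd⟩
        simp only [Pi.add_apply] at this
        linarith [(weight_mem_Icc ν a ⟨0, hd⟩).1, (weight_mem_Icc ν b ⟨0, hd⟩).2]
    rw [this, probReal_univ]
    linarith
  rcases lt_or_ge 1 δ with hδ1 | hδ1
  · refine ⟨.output fun _ => ∅, ⟨SamplingAlgorithm.isMeasurable_output _, fun ν _ => ?_⟩,
      fun X => by simpa [SamplingAlgorithm.samplesDrawn] using hbound⟩
    exact le_trans (by linarith) measureReal_nonneg
  obtain ⟨H, hH, hHcard⟩ := exists_isHittingSet_card_eq hlr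
  have hH1 : 1 ≤ H.card := by
    obtain ⟨e, he, -⟩ := hH ⟨0, hq⟩
    exact Finset.card_pos.2 ⟨e, he⟩
  have hk₀ : 32 / ε ≤ (⌈32 / ε⌉₊ : ℕ) := Nat.le_ceil _
  have hk₀' : ((⌈32 / ε⌉₊ : ℕ) : ℝ) ≤ 33 / ε := by
    have h1 : 1 ≤ 1 / ε := by rwa [le_div_iff₀ hε, one_mul]
    have h2 : 33 / ε = 32 / ε + 1 / ε := by ring
    linarith [Nat.ceil_lt_add_one (show 0 ≤ 32 / ε by positivity)]
  have hk₀pos : 0 < ⌈32 / ε⌉₊ := Nat.ceil_pos.2 (by positivity)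
  choose m hmpos hmle hm using exists_sample_counts hd hH1 hε hε1 hδ hδ1 hk₀pos hk₀'
  obtain ⟨A, hAm, hAp, hAs⟩ := exists_elimination hd p hH hH1 hε hδ hk₀ hmpos hmle hm
    Finset.univ 0
  refine ⟨A, ⟨hAm, fun ν _ => ?_⟩, fun X => (hAs X).trans (le_of_eq ?_)⟩
  · have h := hAp ν fun i b hb => ⟨b, Finset.mem_univ b, hb, fun j => by simp⟩
    have hmeas := hAm.measurableSet_run_mem
      {T | ∀ i, IsParetoOptimal (weight ν) p (l i) (r i) ε (T i)}
    have hc := probReal_compl_eq_one_sub (μ := sampleLaw ν) hmeas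
    rw [pow_zero, div_one] at h
    have : (sampleLaw ν).real {X | A.run X ∈
      {T | ∀ i, IsParetoOptimal (weight ν) p (l i) (r i) ε (T i)}}ᶜ ≤ δ := h
    change 1 - δ ≤ (sampleLaw ν).real {X | A.run X ∈
      {T | ∀ i, IsParetoOptimal (weight ν) p (l i) (r i) ε (T i)}}
    linarith
  -- At `j = 0` the cost factor `4 ^ j * (2 * (j + 2))` is `4`, so the constant is `4 * 6000 =
  -- 24000`.
  · rw [hHcard, Finset.card_univ, Fintype.card_fin]
    simp
    ring

end Existence

end BanditRange

end

theorem mainTheorem2 :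
    ∃ (C : ℝ)
      (alg : (n d q : ℕ) → (Fin n → ℝ) → (Fin q → ℝ) → (Fin q → ℝ) → (ε δ : ℝ) →
        BanditRange.SamplingAlgorithm n d (Fin q → Finset (Fin n))),
      0 < C ∧
      ∀ (n d q : ℕ) (p : Fin n → ℝ) (l r : Fin q → ℝ) (ε δ : ℝ),
        1 ≤ d → 1 ≤ q → (∀ i, l i < r i) → 0 < ε → 0 < δ →
        BanditRange.IsCorrectOn p l r ε δ (alg n d q p l r ε δ) ∧
        ∀ X : BanditRange.SampleTable n d,
          ((alg n d q p l r ε δ).samplesDrawn X : ℝ) ≤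
            C * ((n : ℝ) * (d : ℝ) / ε ^ 2) *
              max 1 (Real.log ((BanditRange.hittingNumber l r : ℝ) * (d : ℝ) / (ε * δ))) := by
  classical
  -- The choice uses only the known data; the distributions are quantified inside `IsCorrectOn`,
  -- after the algorithm is fixed.
  refine ⟨24000, fun n d q p l r ε δ =>
    if h : 1 ≤ d ∧ 1 ≤ q ∧ (∀ i, l i < r i) ∧ 0 < ε ∧ 0 < δ then
      (BanditRange.exists_isCorrectOn p l r ε δ h.1 h.2.1 h.2.2.1 h.2.2.2.1 h.2.2.2.2).choose
    else .output fun _ => ∅, by norm_num, fun n d q p l r ε δ hd hq hlr hε hδ => ?_⟩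
  beta_reduce
  rw [dif_pos ⟨hd, hq, hlr, hε, hδ⟩]
  exact (BanditRange.exists_isCorrectOn p l r ε δ hd hq hlr hε hδ).choose_spec
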